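/- **Setting.** Let $E_X$ be a second countable locally compact Hausdorff space with its Borel $\sigma$-field, $\pi$ a Borel probability measure on $E_X$, and $\mathcal Y\neq\{0\}$ a separable real Hilbert space of finite or infinite dimension, with its Borel $\sigma$-field. Let $k_X$ be a real-valued reproducing kernel on $E_X$ whose RKHS $\mathcal H_X$ is separable, such that $k_X(\cdot,x)$ is measurable for $\pi$-almost all $x$ and $k_X(x,x)\le\kappa_X^2$ for $\pi$-almost all $x$, for some constant $\kappa_X$. Let $I_\pi:\mathcal H_X\to L_2(\pi)$, $f\mapsto[f]$, be the embedding and $L_X=I_\pi I_\pi^*$, $C_{XX}=I_\pi^*I_\pi$. Assume that $L_X$ has infinitely many positive eigenvalues, listed with multiplicities in non-increasing order as $(\mu_i)_{i\ge1}$, and let $e_i\in\mathcal H_X$ satisfy $C_{XX}e_i=\mu_ie_i$ and $L_X[e_i]=\mu_i[e_i]$, with $([e_i])_{i\ge1}$ an orthonormal basis of $\overline{\operatorname{ran} I_\pi}$. For $\alpha\ge0$ let $[\mathcal H]_X^\alpha=\{\sum_i a_i\mu_i^{\alpha/2}[e_i]:a\in\ell_2\}$ be the Hilbert space with norm $\|\sum_i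 a_i\mu_i^{\alpha/2}[e_i]\|_\alpha=\|a\|_{\ell_2}$, and let $[\mathcal G]^\alpha=\Psi(S_2([\mathcal H]_X^\alpha,\mathcal Y))\subseteq L_2(\pi;\mathcal Y)$, where $S_2$ denotes Hilbert–Schmidt operators and $\Psi$ maps $y\otimes f$ to the function $f(\cdot)y$; its norm is $\|\Psi(C)\|_\alpha=\|C\|_{S_2}$. For $\alpha=0$ this is the norm of $L_2(\pi;\mathcal Y)$, and we let $\|\cdot\|_0$ denote that norm on all of $L_2(\pi;\mathcal Y)$. Otherwise put $\|F\|_\alpha=\infty$ if $F\notin[\mathcal G]^\alpha$; for $\alpha=0$ put $\|F\|_0=\infty$ if $F\notin L_2(\pi;\mathcal Y)$. For a distribution $P(dx,dy)=\pi(dx)\,p(x,dy)$ on $E_X\times\mathcal Y$, with a Markov kernel $p$ and $\int\|y\|^2\,dP<\infty$, put $F_*(x)=\int_{\mathcal Y}y\,p(x,dy)$. **Theorem 5.1.** Assume that for some $c_1,c_2>0$ and $0<p\le1$ $$c_2\,i^{-1/p}\le\mu_i\le c_1\,i^{-1/p}\qquad(i\ge1).\tag{EVD+}$$ Then for all $0<\beta\le2$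 and $0\le\gamma\le1$ with $\gamma<\beta$, and all constants $\sigma,R,B>0$, there exist constants $J_0,J,\theta>0$ such that for all learning methods $D\mapsto\hat F_D$ (maps that turn any data set $D=\{(x_i,y_i)\}_{i=1}^n$, $n\ge 1$, into a function $\hat F_D:E_X\to\mathcal Y$), all $\tau>0$ and all sufficiently large $n$, there is a distribution $P$ on $E_X\times\mathcal Y$ with marginal $\pi$ on $E_X$ and $\int\|y\|^2\,dP<\infty$ which satisfies $$F_*\in[\mathcal G]^\beta,\quad\|F_*\|_\beta\le B,\tag{SRC}$$ $$\int_{\mathcal Y}\|y-F_*(x)\|_{\mathcal Y}^q\,p(x,dy)\le\tfrac12\,q!\,\sigma^2R^{q-2}\quad\text{for all integers }q\ge2\text{ and }\pi\text{-almost all }x,\tag{MOM}$$ and such that, for $D$ drawn from $P^n$, with $P^n$-probability at least $1-J_0\tau^{1/\theta}$, $$\|[\hat F_D]-F_*\|_\gamma^2\ \ge\ \tau^2\,J\,n^{-\frac{\beta-\gamma}{\beta+p}}.$$ (If this event is not measurable, its outer $P^n$-probability is meant.) -/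

import Mathlib

open MeasureTheory ProbabilityTheory Filter Topology
open scoped ENNReal

noncomputable section

namespace VectorRegression

/-! ### The scalar RKHS and its embedding into `L²(π)` -/

section Kernel

variable {E : Type*}
  (H : Type*) [NormedAddCommGroup H] [InnerProductSpace ℝ H] [CompleteSpace H] [RKHS ℝ H E ℝ]

/-- The real-valued reproducing kernel `k(x, x')` of the RKHS `H` (Mathlib's kernel takes values in
the operators `ℝ →L[ℝ] ℝ`, which are multiplications by a scalar). -/
def scalarKernel (x x' : E) : ℝ := RKHS.kernel H x x' 1

variable {H}

theorem coe_kerFun (x : E) : ⇑(RKHS.kerFun H x (1 : ℝ)) = fun x' => scalarKernel H x' x := by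
  funext x'
  rw [RKHS.kerFun_apply]
  rfl

theorem abs_apply_le (f : H) (x : E) : |f x| ≤ ‖f‖ * √(scalarKernel H x x) := by
  have h := RKHS.norm_apply_le f x
  have h2 : ‖RKHS.kernel H x x‖ = scalarKernel H x x := by
    have h3 : 0 ≤ scalarKernel H x x := by
      have : inner ℝ (RKHS.kernel H x x 1) (1 : ℝ) =
          inner ℝ (RKHS.kerFun H x (1 : ℝ)) (RKHS.kerFun H x (1 : ℝ)) := RKHS.kernel_inner H x x 1 1
      have h4 : inner ℝ (RKHS.kernel H x x 1) (1 : ℝ) = scalarKernel H x x := by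
        simp [scalarKernel]
      rw [← h4, this]
      exact real_inner_self_nonneg
    have h5 : RKHS.kernel H x x =
        ContinuousLinearMap.toSpanSingleton ℝ (scalarKernel H x x) := by
      ext
      simp [scalarKernel]
    rw [h5, ContinuousLinearMap.norm_toSpanSingleton, Real.norm_of_nonneg h3]
  rwa [h2, Real.norm_eq_abs] at h

end Kernel

section Embedding

variable {E : Type*} [MeasurableSpace E]
  (H : Type*) [NormedAddCommGroup H] [InnerProductSpace ℝ H] [CompleteSpace H] [RKHS ℝ H E ℝ]

/-- The kernel is measurable, and bounded on the diagonal by `κ²`, in the almost everywhere sense: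
`k(·, x)` is measurable for `π`-almost all `x`, and `k(x, x) ≤ κ²` for `π`-almost all `x`. -/
structure KernelAssumptions (π : Measure E) (κ : ℝ) : Prop where
  measurable : ∀ᵐ x ∂π, Measurable fun x' => scalarKernel H x' x
  bounded : ∀ᵐ x ∂π, scalarKernel H x x ≤ κ ^ 2

variable {H}

variable {π : Measure E} {κ : ℝ}

theorem KernelAssumptions.aestronglyMeasurable (h : KernelAssumptions H π κ) (f : H) :
    AEStronglyMeasurable (⇑f) π := by
  set K : Submodule ℝ H := (Submodule.span ℝ
    {g : H | ∃ x : E, (Measurable fun x' => scalarKernel H x' x) ∧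
      g = RKHS.kerFun H x (1 : ℝ)}).topologicalClosure with hK
  have hmeas : ∀ g ∈ K, Measurable (⇑g) := by
    intro g hg
    obtain ⟨u, hu, hlim⟩ := mem_closure_iff_seq_limit.1 hg
    have hum : ∀ n, Measurable (⇑(u n)) := by
      intro n
      refine Submodule.span_induction (p := fun (v : H) _ => Measurable (⇑v)) ?_ ?_ ?_ ?_ (hu n)
      · rintro v ⟨x, hx, rfl⟩
        rw [coe_kerFun]
        exact hx
      · rw [RKHS.coe_zero]
        exact measurable_zero
      · intro v w _ _ hv hw
        rw [RKHS.coe_add]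
        exact hv.add hw
      · intro c v _ hv
        rw [RKHS.coe_smul]
        exact hv.const_smul c
    refine measurable_of_tendsto_metrizable hum ?_
    rw [tendsto_pi_nhds]
    intro x
    exact ((RKHS.continuous_eval x).tendsto g).comp hlim
  have : CompleteSpace K := (Submodule.isClosed_topologicalClosure _).completeSpace_coe
  obtain ⟨g, hg, w, hw, rfl⟩ := K.exists_add_mem_mem_orthogonal f
  have hw0 : ⇑w =ᵐ[π] (0 : E → ℝ) := by
    filter_upwards [h.measurable] with x hx
    have h1 : inner ℝ (RKHS.kerFun H x (1 : ℝ)) w = 0 :=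
      hw _ (Submodule.le_topologicalClosure _ (Submodule.subset_span ⟨x, hx, rfl⟩))
    rw [RKHS.kerFun_inner] at h1
    simpa using h1
  rw [RKHS.coe_add]
  exact (hmeas g hg).aestronglyMeasurable.add
    ((aestronglyMeasurable_const (b := (0 : ℝ))).congr hw0.symm)

theorem KernelAssumptions.ae_norm_le (h : KernelAssumptions H π κ) (f : H) :
    ∀ᵐ x ∂π, ‖f x‖ ≤ |κ| * ‖f‖ := by
  filter_upwards [h.bounded] with x hx
  rw [Real.norm_eq_abs, mul_comm]
  refine (abs_apply_le f x).trans (mul_le_mul_of_nonneg_left ?_ (norm_nonneg _))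
  rw [← Real.sqrt_sq_eq_abs]
  exact Real.sqrt_le_sqrt hx

theorem KernelAssumptions.memLp [IsFiniteMeasure π] (h : KernelAssumptions H π κ) (f : H) :
    MemLp (⇑f) 2 π :=
  MemLp.of_bound (h.aestronglyMeasurable f) _ (h.ae_norm_le f)

/-- The embedding `I_π : H → L²(π)`, sending a function of the RKHS to its class. -/
def embedding [IsProbabilityMeasure π] (h : KernelAssumptions H π κ) : H →L[ℝ] Lp ℝ 2 π :=
  LinearMap.mkContinuous
    { toFun := fun f => (h.memLp f).toLp (⇑f)
      map_add' := fun f g =>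
        (MemLp.toLp_congr (h.memLp (f + g)) ((h.memLp f).add (h.memLp g))
          (.of_eq (RKHS.coe_add f g))).trans (MemLp.toLp_add (h.memLp f) (h.memLp g))
      map_smul' := fun c f =>
        (MemLp.toLp_congr (h.memLp (c • f)) ((h.memLp f).const_smul c)
          (.of_eq (RKHS.coe_smul f c))).trans (MemLp.toLp_const_smul c (h.memLp f)) }
    |κ| (fun f => by
      have h1 := Lp.norm_le_of_ae_bound (f := (h.memLp f).toLp (⇑f))
        (C := |κ| * ‖f‖) (by positivity) (by
          filter_upwards [(h.memLp f).coeFn_toLp, h.ae_norm_le f] with x hx hx'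
          rwa [hx])
      simpa [measureUnivNNReal] using h1)

/-- The covariance operator `C = I_π^* I_π` of the RKHS `H`. -/
def covarianceOp [IsProbabilityMeasure π] (h : KernelAssumptions H π κ) : H →L[ℝ] H :=
  (embedding h).adjoint ∘L embedding h

/-- The integral operator `L = I_π I_π^*` on `L²(π)`. -/
def integralOp [IsProbabilityMeasure π] (h : KernelAssumptions H π κ) :
    Lp ℝ 2 π →L[ℝ] Lp ℝ 2 π :=
  embedding h ∘L (embedding h).adjoint

/-- `(μ_i, e_i)` is a spectral decomposition of the integral and covariance operators with
infinitely many positive eigenvalues: `(μ_i)` lists the positive eigenvalues in non-increasing order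
with multiplicities, the `e_i ∈ H` are eigenvectors of `C`, their classes `[e_i]` are eigenvectors
of `L`, and the `[e_i]` form an orthonormal basis of the closure of the range of `I_π`. (It follows
that `(μ_i^{1/2} e_i)` is an orthonormal basis of the orthogonal complement of `ker I_π`.) -/
structure IsEigensystem [IsProbabilityMeasure π] (h : KernelAssumptions H π κ)
    (μ : ℕ → ℝ) (e : ℕ → H) : Prop where
  pos : ∀ i, 0 < μ i
  antitone : Antitone μ
  eigen_covariance : ∀ i, covarianceOp h (e i) = μ i • e i
  eigen_integral : ∀ i, integralOp h (embedding h (e i)) = μ i • embedding h (e i)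
  orthonormal : Orthonormal ℝ fun i => embedding h (e i)
  complete : (Submodule.span ℝ (Set.range fun i => embedding h (e i))).topologicalClosure =
    (embedding h).range.topologicalClosure

end Embedding

/-- Two-sided polynomial eigenvalue decay `c₂ i^{-1/p} ≤ μ_i ≤ c₁ i^{-1/p}`, `i = 1, 2, …`
(the sequence is indexed from `0` here). -/
def EigenvalueDecay (μ : ℕ → ℝ) (p c₁ c₂ : ℝ) : Prop :=
  ∀ i : ℕ, c₂ * ((i : ℝ) + 1) ^ (-(1 / p)) ≤ μ i ∧ μ i ≤ c₁ * ((i : ℝ) + 1) ^ (-(1 / p))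

/-! ### Vector-valued interpolation spaces -/

section Interpolation

variable {E : Type*} [MeasurableSpace E] {π : Measure E}
  {Y : Type*} [NormedAddCommGroup Y] [InnerProductSpace ℝ Y]

/-- The class of the function `x ↦ f(x) y`, i.e. the elementary tensor `y ⊗ f` seen in
`L²(π; Y)`. -/
def elemTensor (y : Y) (f : Lp ℝ 2 π) : Lp Y 2 π :=
  (ContinuousLinearMap.toSpanSingleton ℝ y).compLp f

/-- The real-valued interpolation space `[H]^α = {∑ a_i μ_i^{α/2} [e_i] : a ∈ ℓ²}` with the norm
`‖∑ a_i μ_i^{α/2} [e_i]‖_α = ‖a‖`, as a Hilbert space: the sequence `a` of coefficients stands for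
the element `∑ a_i μ_i^{α/2} [e_i]`. -/
abbrev RealInterp : Type := lp (fun _ : ℕ => ℝ) 2

/-- The `i`-th vector of the orthonormal basis of `[H]^α`; it stands for `μ_i^{α/2} [e_i]`. -/
def RealInterp.basis (i : ℕ) : RealInterp := lp.single 2 i (1 : ℝ)

/-- The Hilbert-Schmidt norm of an operator `C : [H]^α → Y` (it is `∞` if `C` is not
Hilbert-Schmidt). -/
def hilbertSchmidtNorm (C : RealInterp →L[ℝ] Y) : ℝ≥0∞ :=
  (∑' i, ‖C (RealInterp.basis i)‖ₑ ^ 2) ^ (1 / 2 : ℝ)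

/-- `F = Ψ(C)` for an operator `C : [H]^α → Y`. The isometry `Ψ` sends `y ⊗ f` to the function
`x ↦ f(x) y`, and `C = ∑ C(u_i) ⊗ u_i` for the orthonormal basis `u_i = μ_i^{α/2} [e_i]`. Here `v i`
is the class `[e_i]`. -/
def IsPsi (μ : ℕ → ℝ) (v : ℕ → Lp ℝ 2 π) (α : ℝ) (C : RealInterp →L[ℝ] Y) (F : Lp Y 2 π) : Prop :=
  HasSum (fun i => elemTensor (C (RealInterp.basis i)) (μ i ^ (α / 2) • v i)) F

open Classical in
/-- The norm `‖F‖_α = ‖C‖_{S₂([H]^α, Y)}`, `F = Ψ(C)`, of the vector-valued interpolation space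
`[G]^α = Ψ(S₂([H]^α, Y))`, extended by `∞` outside `[G]^α` (there is at most one `C` with
`Ψ(C) = F`). For `α = 0` it is the norm of `L²(π; Y)`, which is the same on `[G]^0` and is finite on
all of `L²(π; Y)`. A function which is not square integrable has norm `∞`. -/
def interpNorm (μ : ℕ → ℝ) (v : ℕ → Lp ℝ 2 π) (α : ℝ) (F : E → Y) : ℝ≥0∞ :=
  if hF : MemLp F 2 π then
    if α = 0 then eLpNorm F 2 π
    else ⨅ (C : RealInterp →L[ℝ] Y) (_ : IsPsi μ v α C (hF.toLp F)), hilbertSchmidtNorm C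
  else ∞

end Interpolation

/-! ### The regression model -/

section Model

variable {E : Type*} [MeasurableSpace E]
  {Y : Type*} [NormedAddCommGroup Y] [InnerProductSpace ℝ Y] [MeasurableSpace Y]

/-- The regression function `F_*(x) = ∫ y p(x, dy)`. -/
def regressionFun (p : Kernel E Y) (x : E) : Y := ∫ y, y ∂(p x)

/-- The Bernstein moment condition
`∫ ‖y - F_*(x)‖^q p(x, dy) ≤ q! σ² R^{q-2} / 2` for all `q ≥ 2` and `π`-almost all `x`. -/
def MomentCondition (π : Measure E) (p : Kernel E Y) (σ R : ℝ) : Prop :=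
  ∀ᵐ x ∂π, ∀ q : ℕ, 2 ≤ q →
    ∫⁻ y, ‖y - regressionFun p x‖ₑ ^ q ∂(p x) ≤
      ENNReal.ofReal (1 / 2 * (q.factorial : ℝ) * σ ^ 2 * R ^ (q - 2))

/-- A learning method: it turns every data set of any size `n` into a function `E → Y`. -/
abbrev LearningMethod (E Y : Type*) : Type _ := (n : ℕ) → (Fin n → E × Y) → E → Y

end Model

end VectorRegression

end

/-! The bound comes from testing hypotheses indexed by a hypercube. For a unit vector `y₀` and `w`
in `{0,1}^m` let the regression function be `d ∑_j w_j [e_{m+j}] y₀`, and let the noise be Gaussian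
along `y₀` with variance `s²`. The noise is one-dimensional, so the moment condition holds for small
`s` whatever the dimension of `Y`, and the relative entropy to the pure noise model is at most `m d²
/ (2 s²)` per observation.

The indices `m + j` with `j < m` form one block on which `μ_i` is of order `m^{-1/p}`. The squared
`β`-norm of a hypothesis is thus at most of order `d² m^{1+β/p}`, while the squared `γ`-distance of
two hypotheses is at least of order `d² m^{γ/p}` times their Hamming distance. An estimate which is
`γ`-close to the truth therefore determines `w` up to Hamming distance `m/4`
(`hammingDist_le_of_interpNorm_lt`).

By `le_of_le_pi_real` this cannot succeed for all `w` with high probability. A change of measure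
moves each success event to the common pure noise law, where at a given data set at most `(3/2)^m
2^{m/4}` of the `2^m` events can occur together. Averaging over the whole cube replaces a Fano
argument on a packing subset.

With `ρ = τ^{1/θ}` the choice is `d² = ρ/n`, so the total entropy is at most `m ρ / (2 s²)` and the
success probability of order `ρ`; `m` is taken as large as the source condition permits
(`eventually_exists_dimension`). The separation is then of order `(ρ/n)^{(β-γ)/(β+p)} = τ²
n^{-(β-γ)/(β+p)}`. -/

namespace VectorRegression

/-! ### Change of measure on product spaces -/

section ChangeOfMeasure

variable {Z : Type*} [MeasurableSpace Z]

/-- It suffices to compare on boxes, where the indicator times the product density is a product of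
functions of independent coordinates. -/
theorem pi_withDensity {n : ℕ} (Q : Measure Z) [IsProbabilityMeasure Q] (g : Z → ℝ≥0∞)
    (hg : Measurable g) [IsProbabilityMeasure (Q.withDensity g)] :
    (Measure.pi fun _ : Fin n => Q.withDensity g) =
      (Measure.pi fun _ : Fin n => Q).withDensity fun z => ∏ i, g (z i) := by
  refine Measure.pi_eq fun s hs => ?_
  have hfun : ∀ z : Fin n → Z, (Set.univ.pi s).indicator (fun z => ∏ i, g (z i)) z =
      ∏ i, (s i).indicator g (z i) := by
    intro z
    by_cases hz : z ∈ Set.univ.pi s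
    · rw [Set.indicator_of_mem hz]
      exact Finset.prod_congr rfl fun i _ =>
        (Set.indicator_of_mem (hz i (Set.mem_univ i)) g).symm
    · rw [Set.indicator_of_notMem hz]
      obtain ⟨i, hi⟩ : ∃ i, z i ∉ s i := by simpa [Set.mem_pi] using hz
      exact (Finset.prod_eq_zero (Finset.mem_univ i) (Set.indicator_of_notMem hi g)).symm
  have hm : ∀ i, Measurable ((s i).indicator g) := fun i => hg.indicator (hs i)
  rw [withDensity_apply _ (MeasurableSet.univ_pi hs),
    ← lintegral_indicator (MeasurableSet.univ_pi hs)]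
  simp_rw [hfun]
  rw [lintegral_prod_eq_prod_lintegral_of_indepFun Finset.univ _
    (iIndepFun_pi fun i => (hm i).aemeasurable) fun i => (hm i).comp (measurable_pi_apply i)]
  refine Finset.prod_congr rfl fun i _ => ?_
  rw [withDensity_apply _ (hs i), ← lintegral_indicator (hs i)]
  exact (measurePreserving_eval (fun _ : Fin n => Q) i).lintegral_comp (hm i)

/-- If `P` has the log-density `l` with respect to `Q`, with relative entropy `∫ l dP`, then the
`P^n`-probability of an event is controlled by its `Q^n`-probability. -/
theorem pi_real_le_exp_mul_add {n : ℕ} (Q P : Measure Z) [IsProbabilityMeasure Q]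
    [IsProbabilityMeasure P] (l : Z → ℝ) (hl : Measurable l)
    (hP : P = Q.withDensity fun z => ENNReal.ofReal (Real.exp (l z))) (hint : Integrable l P)
    {t : ℝ} (ht : 0 < t) {B : Set (Fin n → Z)} (hB : MeasurableSet B) :
    (Measure.pi fun _ : Fin n => P).real B ≤
      Real.exp t * (Measure.pi fun _ : Fin n => Q).real B + (n * ∫ z, l z ∂P + 1) / t := by
  set PP := Measure.pi fun _ : Fin n => P with hPP
  set QQ := Measure.pi fun _ : Fin n => Q with hQQ
  set S : (Fin n → Z) → ℝ := fun z => ∑ i, l (z i) with hS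
  have hSm : Measurable S :=
    Finset.measurable_sum _ fun i _ => hl.comp (measurable_pi_apply i)
  have hdens : PP = QQ.withDensity fun z => ENNReal.ofReal (Real.exp (S z)) := by
    subst hP
    rw [hPP, pi_withDensity Q _ (by fun_prop)]
    congr 1
    funext z
    rw [hS, Real.exp_sum, ENNReal.ofReal_prod_of_nonneg fun _ _ => (Real.exp_pos _).le]
  have hev : ∀ i, MeasurePreserving (Function.eval i) PP P :=
    measurePreserving_eval fun _ : Fin n => P
  have hinti : ∀ i, Integrable (fun z : Fin n → Z => l (z i)) PP := fun i =>
    (hev i).integrable_comp_of_integrable hint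
  have hSint : Integrable S PP := integrable_finsetSum _ fun i _ => hinti i
  have hSval : ∫ z, S z ∂PP = n * ∫ z, l z ∂P := by
    rw [hS, integral_finsetSum _ fun i _ => hinti i]
    have : ∀ i : Fin n, ∫ z, l (z i) ∂PP = ∫ z, l z ∂P := by
      intro i
      have h := (hev i).map_eq
      rw [← h, integral_map (hev i).measurable.aemeasurable (by
        rw [h]; exact hint.aestronglyMeasurable)]
    simp [this]
  -- `exp (-S)` cancels the density, leaving the total mass of `QQ`.
  have hlone : ∫⁻ z, ENNReal.ofReal (Real.exp (-S z)) ∂PP = 1 := by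
    rw [hdens, lintegral_withDensity_eq_lintegral_mul _ (by fun_prop) (by fun_prop)]
    simp only [Pi.mul_apply, ← ENNReal.ofReal_mul (Real.exp_pos _).le, ← Real.exp_add]
    simp
  have hnint : Integrable (fun z => Real.exp (-S z)) PP := by
    refine ⟨by fun_prop, ?_⟩
    rw [hasFiniteIntegral_iff_ofReal (.of_forall fun z => (Real.exp_pos _).le), hlone]
    exact ENNReal.one_lt_top
  have hnval : ∫ z, Real.exp (-S z) ∂PP = 1 := by
    rw [integral_eq_lintegral_of_nonneg_ae (.of_forall fun z => (Real.exp_pos _).le) (by fun_prop),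
      hlone, ENNReal.toReal_one]
  -- `S` may be negative, so Markov's inequality is applied to `S + exp (-S)`, which is nonnegative
  -- and exceeds the mean of `S` by only `1`. No variance of the log-likelihood is needed.
  have hmarkov : PP.real {z | t ≤ S z} ≤ (n * ∫ z, l z ∂P + 1) / t := by
    rw [le_div_iff₀' ht]
    have h := mul_meas_ge_le_integral_of_nonneg (μ := PP) (f := fun z => S z + Real.exp (-S z))
      (.of_forall fun z => by
        have := Real.add_one_le_exp (-S z)
        simp only [Pi.zero_apply]
        linarith) (hSint.add hnint) t
    rw [integral_add hSint hnint, hSval, hnval] at h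
    refine le_trans (mul_le_mul_of_nonneg_left ?_ ht.le) h
    refine measureReal_mono (fun z hz => ?_)
    have := Real.exp_pos (-S z)
    simp only [Set.mem_ofPred_eq] at hz ⊢
    linarith
  have hsmall : PP.real (B ∩ {z | S z < t}) ≤ Real.exp t * QQ.real B := by
    have hBm : MeasurableSet (B ∩ {z | S z < t}) :=
      hB.inter (measurableSet_lt hSm measurable_const)
    have h1 : PP (B ∩ {z | S z < t}) ≤ ENNReal.ofReal (Real.exp t) * QQ B := by
      rw [hdens, withDensity_apply _ hBm]
      calc ∫⁻ z in B ∩ {z | S z < t}, ENNReal.ofReal (Real.exp (S z)) ∂QQ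
          ≤ ∫⁻ z in B ∩ {z | S z < t}, ENNReal.ofReal (Real.exp t) ∂QQ :=
            setLIntegral_mono measurable_const fun z hz =>
              ENNReal.ofReal_le_ofReal (Real.exp_le_exp.2 (le_of_lt hz.2))
        _ = ENNReal.ofReal (Real.exp t) * QQ (B ∩ {z | S z < t}) := setLIntegral_const _ _
        _ ≤ _ := by gcongr; exact Set.inter_subset_left
    have h2 := ENNReal.toReal_mono (by finiteness) h1
    rwa [ENNReal.toReal_mul, ENNReal.toReal_ofReal (Real.exp_pos _).le] at h2
  calc PP.real B ≤ PP.real ((B ∩ {z | S z < t}) ∪ {z | t ≤ S z}) := by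
        refine measureReal_mono (fun z hz => ?_)
        rcases lt_or_ge (S z) t with h | h
        · exact Or.inl ⟨hz, h⟩
        · exact Or.inr h
    _ ≤ PP.real (B ∩ {z | S z < t}) + PP.real {z | t ≤ S z} := measureReal_union_le _ _
    _ ≤ _ := add_le_add hsmall hmarkov

/-- The sum is the mean number of events that occur. -/
theorem sum_real_le_of_card_le {ι : Type*} [Fintype ι] (Q : Measure Z) [IsProbabilityMeasure Q]
    (B : ι → Set Z) (hB : ∀ i, MeasurableSet (B i)) (N : ℝ)
    (hN : ∀ z, ∀ s : Finset ι, (∀ i ∈ s, z ∈ B i) → (s.card : ℝ) ≤ N) :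
    ∑ i, Q.real (B i) ≤ N := by
  classical
  have h1 : ∀ i, Q.real (B i) = ∫ z, (B i).indicator 1 z ∂Q := fun i =>
    (integral_indicator_one (hB i)).symm
  have hint : ∀ i, Integrable ((B i).indicator (1 : Z → ℝ)) Q := fun i =>
    (integrable_const (1 : ℝ)).indicator (hB i)
  simp_rw [h1]
  rw [← integral_finsetSum _ fun i _ => hint i]
  calc ∫ z, ∑ i, (B i).indicator (1 : Z → ℝ) z ∂Q ≤ ∫ _, N ∂Q := by
        refine integral_mono (integrable_finsetSum _ fun i _ => hint i) (integrable_const N) ?_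
        intro z
        have h2 : ∑ i, (B i).indicator (1 : Z → ℝ) z = ((Finset.univ.filter (z ∈ B ·)).card : ℝ) := by
          simp [Set.indicator_apply]
        change ∑ i, (B i).indicator (1 : Z → ℝ) z ≤ N
        rw [h2]
        exact hN z _ fun i hi => (Finset.mem_filter.1 hi).2
    _ = N := by simp

end ChangeOfMeasure

/-! ### Gaussian noise along a fixed direction -/

section Gaussian

/-- One term of the exponential series gives `|r|^q ≤ q! s^q exp(|r|/s)`, and `exp(|r|/s) ≤ exp(r/s)
+ exp(-r/s)` has mean at most `2 exp(1/2) ≤ 4`. The factor `8` in `hσ` absorbs this `4` and the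
`1/2` of the moment condition. -/
theorem lintegral_enorm_pow_gaussianReal_le {s σ R : ℝ} (hs : 0 < s) (hsR : s ≤ R)
    (hσ : 8 * s ^ 2 ≤ σ ^ 2) {q : ℕ} (hq : 2 ≤ q) :
    ∫⁻ r, ‖r‖ₑ ^ q ∂gaussianReal 0 (s ^ 2).toNNReal ≤
      ENNReal.ofReal (1 / 2 * (q.factorial : ℝ) * σ ^ 2 * R ^ (q - 2)) := by
  set ν := gaussianReal 0 (s ^ 2).toNNReal
  have hexp : ∀ t : ℝ, t ^ 2 = (1 / s) ^ 2 →
      ∫⁻ r, ENNReal.ofReal (Real.exp (t * r)) ∂ν = ENNReal.ofReal (Real.exp (1 / 2)) := by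
    intro t ht
    rw [← ofReal_integral_eq_lintegral_ofReal (integrable_exp_mul_gaussianReal t)
      (.of_forall fun r => (Real.exp_pos _).le)]
    have h := congrFun (mgf_id_gaussianReal (μ := 0) (v := (s ^ 2).toNNReal)) t
    rw [mgf] at h
    simp only [id_eq] at h
    rw [h, Real.coe_toNNReal _ (sq_nonneg s), ht]
    congr 2
    field_simp
    ring
  have hpt : ∀ r : ℝ, ‖r‖ₑ ^ q ≤ ENNReal.ofReal (q.factorial * s ^ q) *
      (ENNReal.ofReal (Real.exp (1 / s * r)) + ENNReal.ofReal (Real.exp (-(1 / s) * r))) := by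
    intro r
    rw [← ENNReal.ofReal_add (Real.exp_pos _).le (Real.exp_pos _).le,
      ← ENNReal.ofReal_mul (by positivity), Real.enorm_eq_ofReal_abs,
      ← ENNReal.ofReal_pow (abs_nonneg r)]
    refine ENNReal.ofReal_le_ofReal ?_
    have h1 : (|r| / s) ^ q / q.factorial ≤ Real.exp (|r| / s) :=
      Real.pow_div_factorial_le_exp _ (by positivity) q
    have h2 : Real.exp (|r| / s) ≤ Real.exp (1 / s * r) + Real.exp (-(1 / s) * r) := by
      rcases abs_cases r with ⟨h, -⟩ | ⟨h, -⟩ <;> rw [h]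
      · rw [show r / s = 1 / s * r by ring]
        exact le_add_of_nonneg_right (Real.exp_pos _).le
      · rw [show -r / s = -(1 / s) * r by ring]
        exact le_add_of_nonneg_left (Real.exp_pos _).le
    have h3 := h1.trans h2
    rw [div_le_iff₀ (by positivity), div_pow, div_le_iff₀ (by positivity)] at h3
    linarith
  have he : Real.exp (1 / 2) ≤ 2 := by
    have h := Real.exp_bound_div_one_sub_of_interval (x := 1 / 2) (by norm_num) (by norm_num)
    norm_num at h ⊢
    exact h
  calc ∫⁻ r, ‖r‖ₑ ^ q ∂ν ≤ ∫⁻ r, ENNReal.ofReal (q.factorial * s ^ q) *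
      (ENNReal.ofReal (Real.exp (1 / s * r)) + ENNReal.ofReal (Real.exp (-(1 / s) * r))) ∂ν :=
        lintegral_mono hpt
    _ = ENNReal.ofReal (q.factorial * s ^ q) *
        (ENNReal.ofReal (Real.exp (1 / 2)) + ENNReal.ofReal (Real.exp (1 / 2))) := by
        rw [lintegral_const_mul _ (by fun_prop), lintegral_add_left (by fun_prop), hexp _ rfl,
          hexp _ (by ring)]
    _ = ENNReal.ofReal (q.factorial * s ^ q * (Real.exp (1 / 2) + Real.exp (1 / 2))) := by
        rw [← ENNReal.ofReal_add (Real.exp_pos _).le (Real.exp_pos _).le,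
          ← ENNReal.ofReal_mul (by positivity)]
    _ ≤ _ := by
        refine ENNReal.ofReal_le_ofReal ?_
        obtain ⟨k, rfl⟩ := Nat.exists_eq_add_of_le hq
        rw [show 2 + k - 2 = k by omega]
        have h1 : s ^ k ≤ R ^ k := pow_le_pow_left₀ hs.le hsR k
        have h2 : s ^ (2 + k) * (Real.exp (1 / 2) + Real.exp (1 / 2)) ≤ 1 / 2 * σ ^ 2 * R ^ k := by
          calc s ^ (2 + k) * (Real.exp (1 / 2) + Real.exp (1 / 2)) ≤ s ^ (2 + k) * 4 := by
                exact mul_le_mul_of_nonneg_left (by linarith) (by positivity)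
            _ = (4 * s ^ 2) * s ^ k := by ring
            _ ≤ (1 / 2 * σ ^ 2) * R ^ k :=
                mul_le_mul (by linarith) h1 (by positivity) (by positivity)
        have h3 := mul_le_mul_of_nonneg_left h2 (Nat.cast_nonneg (α := ℝ) (2 + k).factorial)
        linarith

variable {E : Type*} [MeasurableSpace E]

/-- The kernel `x ↦ N(f(x), v)` on the real line. -/
noncomputable def gaussianKernel (f : E → ℝ) (hf : Measurable f) (v : NNReal) : Kernel E ℝ where
  toFun x := gaussianReal (f x) v
  measurable' := measurable_gaussianReal.comp (hf.prodMk measurable_const)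

variable {Y : Type*} [NormedAddCommGroup Y] [InnerProductSpace ℝ Y]
  [MeasurableSpace Y] [BorelSpace Y]

/-- The conditional distribution of `(f(x) + ε) y₀` with `ε` centred Gaussian of variance `v`. -/
noncomputable def noiseKernel (f : E → ℝ) (hf : Measurable f) (v : NNReal) (y₀ : Y) : Kernel E Y :=
  (gaussianKernel f hf v).map fun r => r • y₀

variable {f : E → ℝ} {hf : Measurable f} {v : NNReal} {y₀ : Y}

instance : IsMarkovKernel (gaussianKernel f hf v) :=
  ⟨fun x => inferInstanceAs (IsProbabilityMeasure (gaussianReal (f x) v))⟩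

theorem measurable_smul_const' : Measurable fun r : ℝ => r • y₀ :=
  (by fun_prop : Continuous fun r : ℝ => r • y₀).measurable

instance : IsMarkovKernel (noiseKernel f hf v y₀) :=
  Kernel.IsMarkovKernel.map _ measurable_smul_const'

theorem noiseKernel_apply (x : E) :
    noiseKernel f hf v y₀ x = (gaussianReal (f x) v).map fun r => r • y₀ :=
  Kernel.map_apply _ measurable_smul_const' _

theorem lintegral_noiseKernel (x : E) {g : Y → ℝ≥0∞} (hg : Measurable g) :
    ∫⁻ y, g y ∂noiseKernel f hf v y₀ x = ∫⁻ r, g ((f x + r) • y₀) ∂gaussianReal 0 v := by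
  have hm : Measurable fun r : ℝ => g (r • y₀) := hg.comp measurable_smul_const'
  have hx : gaussianReal (f x) v = (gaussianReal 0 v).map (f x + ·) := by
    rw [gaussianReal_map_const_add, zero_add]
  rw [noiseKernel_apply, lintegral_map hg measurable_smul_const', hx,
    lintegral_map hm (by fun_prop)]

variable [TopologicalSpace.SeparableSpace Y]

theorem regressionFun_noiseKernel [CompleteSpace Y] (x : E) :
    regressionFun (noiseKernel f hf v y₀) x = f x • y₀ := by
  rw [regressionFun, noiseKernel_apply, integral_map measurable_smul_const'.aemeasurable
    measurable_id'.aestronglyMeasurable, integral_smul_const, integral_id_gaussianReal]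

theorem momentCondition_noiseKernel [CompleteSpace Y] (π : Measure E) {s σ R : ℝ} (hs : 0 < s)
    (hsR : s ≤ R)
    (hσ : 8 * s ^ 2 ≤ σ ^ 2) (hy : ‖y₀‖ = 1) :
    MomentCondition π (noiseKernel f hf (s ^ 2).toNNReal y₀) σ R := by
  refine .of_forall fun x q hq => ?_
  rw [regressionFun_noiseKernel, lintegral_noiseKernel x (by fun_prop)]
  refine le_trans (le_of_eq ?_) (lintegral_enorm_pow_gaussianReal_le hs hsR hσ hq)
  refine lintegral_congr fun r => ?_
  rw [add_smul, add_sub_cancel_left, enorm_smul, ← ofReal_norm y₀, hy]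
  simp

theorem lintegral_enorm_sq_noiseKernel_lt_top (π : Measure E) [IsProbabilityMeasure π]
    (hfL : MemLp f 2 π) (hy : ‖y₀‖ = 1) :
    ∫⁻ z, ‖z.2‖ₑ ^ 2 ∂(π ⊗ₘ noiseKernel f hf v y₀) < ∞ := by
  rw [Measure.lintegral_compProd (by fun_prop)]
  have hg : ∫⁻ r, ‖r‖ₑ ^ 2 ∂gaussianReal 0 v < ∞ := by
    have h := (memLp_id_gaussianReal' (μ := 0) (v := v) 2 (by simp)).eLpNorm_lt_top
    have h2 := lintegral_rpow_enorm_lt_top_of_eLpNorm_lt_top (by simp) (by simp) h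
    simpa using h2
  have hf2 : ∫⁻ x, ‖f x‖ₑ ^ 2 ∂π < ∞ := by
    have h2 := lintegral_rpow_enorm_lt_top_of_eLpNorm_lt_top (by simp) (by simp) hfL.eLpNorm_lt_top
    simpa using h2
  have hpt : ∀ x, ∫⁻ y, ‖y‖ₑ ^ 2 ∂noiseKernel f hf v y₀ x ≤
      2 * ‖f x‖ₑ ^ 2 + 2 * ∫⁻ r, ‖r‖ₑ ^ 2 ∂gaussianReal 0 v := by
    intro x
    rw [lintegral_noiseKernel x (by fun_prop)]
    calc ∫⁻ r, ‖(f x + r) • y₀‖ₑ ^ 2 ∂gaussianReal 0 v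
        ≤ ∫⁻ r, (2 * ‖f x‖ₑ ^ 2 + 2 * ‖r‖ₑ ^ 2) ∂gaussianReal 0 v := by
          refine lintegral_mono fun r => ?_
          have h1 : ‖(f x + r) • y₀‖ₑ ^ 2 = ENNReal.ofReal ((f x + r) ^ 2) := by
            rw [← ofReal_norm, norm_smul, hy, mul_one, ← ENNReal.ofReal_pow (norm_nonneg _),
              Real.norm_eq_abs, sq_abs]
          have h2 : ∀ a : ℝ, ‖a‖ₑ ^ 2 = ENNReal.ofReal (a ^ 2) := by
            intro a
            rw [Real.enorm_eq_ofReal_abs, ← ENNReal.ofReal_pow (abs_nonneg _), sq_abs]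
          rw [h1, h2, h2, show (2 : ℝ≥0∞) = ENNReal.ofReal 2 by simp,
            ← ENNReal.ofReal_mul (by norm_num), ← ENNReal.ofReal_mul (by norm_num),
            ← ENNReal.ofReal_add (by positivity) (by positivity)]
          exact ENNReal.ofReal_le_ofReal (by nlinarith [sq_nonneg (f x - r)])
      _ = _ := by
          rw [lintegral_add_left (by fun_prop), lintegral_const, measure_univ, mul_one,
            lintegral_const_mul _ (by fun_prop)]
  refine (lintegral_mono hpt).trans_lt ?_
  rw [lintegral_add_right _ measurable_const, lintegral_const_mul _ (by fun_prop)]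
  simp only [lintegral_const, measure_univ, mul_one]
  exact ENNReal.add_lt_top.2 ⟨ENNReal.mul_lt_top (by simp) hf2, ENNReal.mul_lt_top (by simp) hg⟩

/-- The log-likelihood ratio of `noiseKernel f` against `noiseKernel 0`. -/
noncomputable def noiseLogLikelihood (f : E → ℝ) (v : NNReal) (y₀ : Y) (z : E × Y) : ℝ :=
  (f z.1 * inner ℝ y₀ z.2 - f z.1 ^ 2 / 2) / v

theorem measurable_noiseLogLikelihood (hf : Measurable f) :
    Measurable (noiseLogLikelihood f v y₀) := by
  unfold noiseLogLikelihood
  fun_prop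

theorem gaussianReal_eq_withDensity (hv : v ≠ 0) (m : ℝ) :
    gaussianReal m v = (gaussianReal 0 v).withDensity
      fun r => ENNReal.ofReal (Real.exp ((m * r - m ^ 2 / 2) / v)) := by
  rw [gaussianReal_of_var_ne_zero _ hv, gaussianReal_of_var_ne_zero _ hv,
    ← withDensity_mul _ (measurable_gaussianPDF _ _) (by fun_prop)]
  congr 1
  funext r
  have hv' : (v : ℝ) ≠ 0 := by exact_mod_cast hv
  rw [Pi.mul_apply, gaussianPDF, gaussianPDF, ← ENNReal.ofReal_mul (gaussianPDFReal_nonneg _ _ _),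
    gaussianPDFReal, gaussianPDFReal, mul_assoc (√_)⁻¹, ← Real.exp_add]
  congr 3
  field_simp
  ring

theorem noiseKernel_eq_withDensity (hv : v ≠ 0) (hy : ‖y₀‖ = 1) (x : E) :
    noiseKernel f hf v y₀ x = ((gaussianReal 0 v).map fun r => r • y₀).withDensity
      fun y => ENNReal.ofReal (Real.exp (noiseLogLikelihood f v y₀ (x, y))) := by
  have hm : Measurable fun y : Y =>
      ENNReal.ofReal (Real.exp (noiseLogLikelihood f v y₀ (x, y))) :=
    ((measurable_noiseLogLikelihood hf).comp measurable_prodMk_left).exp.ennreal_ofReal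
  ext s hs
  rw [noiseKernel_apply, Measure.map_apply measurable_smul_const' hs, withDensity_apply _ hs,
    gaussianReal_eq_withDensity hv, withDensity_apply _ (measurable_smul_const' hs),
    setLIntegral_map hs hm measurable_smul_const']
  simp [noiseLogLikelihood, inner_smul_right, hy]

theorem compProd_noiseKernel_eq_withDensity (π : Measure E) [IsProbabilityMeasure π]
    (hv : v ≠ 0) (hy : ‖y₀‖ = 1) :
    π ⊗ₘ noiseKernel f hf v y₀ = (π.prod ((gaussianReal 0 v).map fun r => r • y₀)).withDensity
      fun z => ENNReal.ofReal (Real.exp (noiseLogLikelihood f v y₀ z)) := by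
  set ν := (gaussianReal 0 v).map fun r => r • y₀
  have : IsProbabilityMeasure ν :=
    Measure.isProbabilityMeasure_map measurable_smul_const'.aemeasurable
  have hm : Measurable (Function.uncurry fun (x : E) (y : Y) =>
      ENNReal.ofReal (Real.exp (noiseLogLikelihood f v y₀ (x, y)))) :=
    (measurable_noiseLogLikelihood hf).exp.ennreal_ofReal
  have hk : noiseKernel f hf v y₀ = (Kernel.const E ν).withDensity fun x y =>
      ENNReal.ofReal (Real.exp (noiseLogLikelihood f v y₀ (x, y))) := by
    refine Kernel.ext fun x => ?_
    rw [Kernel.withDensity_apply _ hm, noiseKernel_eq_withDensity hv hy, Kernel.const_apply]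
  have hM : IsMarkovKernel ((Kernel.const E ν).withDensity fun x y =>
      ENNReal.ofReal (Real.exp (noiseLogLikelihood f v y₀ (x, y)))) := by
    rw [← hk]; infer_instance
  rw [hk, Measure.compProd_withDensity hm, Measure.compProd_const]

/-- This is the relative entropy: given `x`, the response has mean `f x` along `y₀`, so the
log-likelihood averages to `(f x ^ 2 - f x ^ 2 / 2) / v`. -/
theorem integrable_integral_noiseLogLikelihood (π : Measure E) [IsProbabilityMeasure π]
    (hfL : MemLp f 2 π) (hv : v ≠ 0) (hy : ‖y₀‖ = 1) :
    Integrable (noiseLogLikelihood f v y₀) (π ⊗ₘ noiseKernel f hf v y₀) ∧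
      ∫ z, noiseLogLikelihood f v y₀ z ∂(π ⊗ₘ noiseKernel f hf v y₀) =
        (∫ x, f x ^ 2 ∂π) / (2 * v) := by
  set P := π ⊗ₘ noiseKernel f hf v y₀ with hP
  have hfst : MeasurePreserving Prod.fst P π :=
    ⟨measurable_fst, Measure.fst_compProd π (noiseKernel f hf v y₀)⟩
  have h1 : MemLp (fun z : E × Y => f z.1) 2 P := hfL.comp_measurePreserving hfst
  have h2 : MemLp (fun z : E × Y => z.2) 2 P := by
    refine ⟨measurable_snd.aestronglyMeasurable, ?_⟩
    rw [eLpNorm_lt_top_iff_lintegral_rpow_enorm_lt_top (by simp) (by simp)]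
    simpa using lintegral_enorm_sq_noiseKernel_lt_top (hf := hf) (v := v) π hfL hy
  have h3 : MemLp (fun z : E × Y => inner ℝ y₀ z.2) 2 P := h2.const_inner y₀
  have hint : Integrable (noiseLogLikelihood f v y₀) P :=
    ((h1.integrable_mul h3).sub (h1.integrable_sq.div_const 2)).div_const _
  refine ⟨hint, ?_⟩
  rw [Measure.integral_compProd hint, ← integral_div]
  refine integral_congr_ae (.of_forall fun x => ?_)
  have hi : Integrable (fun r : ℝ => r) (gaussianReal (f x) v) :=
    (memLp_id_gaussianReal 1).integrable le_rfl
  simp only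
  have hm : Measurable fun y => noiseLogLikelihood f v y₀ (x, y) :=
    (measurable_noiseLogLikelihood hf).comp measurable_prodMk_left
  rw [noiseKernel_apply, integral_map measurable_smul_const'.aemeasurable
    hm.aestronglyMeasurable]
  simp only [noiseLogLikelihood, inner_smul_right, real_inner_self_eq_norm_sq, hy, one_pow, mul_one]
  rw [integral_div, integral_sub (hi.const_mul _) (integrable_const _), integral_const_mul,
    integral_id_gaussianReal]
  have hv' : (v : ℝ) ≠ 0 := by exact_mod_cast hv
  simp
  field_simp
  ring

end Gaussian

/-! ### Interpolation norms of simple tensors -/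

section InterpolationBounds

variable {E : Type*} [MeasurableSpace E] {π : Measure E}
  {Y : Type*} [NormedAddCommGroup Y] [InnerProductSpace ℝ Y]

theorem coeFn_elemTensor (y : Y) (f : Lp ℝ 2 π) :
    ⇑(elemTensor y f) =ᵐ[π] fun x => f x • y :=
  ContinuousLinearMap.coeFn_compLp _ f

theorem elemTensor_eq_compLpL (y : Y) (f : Lp ℝ 2 π) :
    elemTensor y f = (ContinuousLinearMap.toSpanSingleton ℝ y).compLpL 2 π f := rfl

theorem elemTensor_smul_left (c : ℝ) (y : Y) (f : Lp ℝ 2 π) :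
    elemTensor (c • y) f = c • elemTensor y f := by
  refine Lp.ext ?_
  filter_upwards [coeFn_elemTensor (c • y) f, coeFn_elemTensor y f,
    Lp.coeFn_smul c (elemTensor y f)] with x h1 h2 h3
  rw [h1, h3, Pi.smul_apply, h2, smul_comm]

theorem inner_elemTensor (y y' : Y) (f g : Lp ℝ 2 π) :
    inner ℝ (elemTensor y f) (elemTensor y' g) = inner ℝ y y' * inner ℝ f g := by
  rw [L2.inner_def, L2.inner_def, ← integral_const_mul]
  refine integral_congr_ae ?_
  filter_upwards [coeFn_elemTensor y f, coeFn_elemTensor y' g] with x h1 h2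
  rw [h1, h2, inner_smul_left, inner_smul_right]
  simp
  ring

theorem orthonormal_elemTensor {v : ℕ → Lp ℝ 2 π} (hv : Orthonormal ℝ v) {y : Y} (hy : ‖y‖ = 1) :
    Orthonormal ℝ fun i => elemTensor y (v i) := by
  rw [orthonormal_iff_ite] at hv ⊢
  intro i j
  rw [inner_elemTensor, hv, real_inner_self_eq_norm_sq, hy]
  simp

theorem hilbertSchmidtNorm_sq (C : RealInterp →L[ℝ] Y) :
    hilbertSchmidtNorm C ^ 2 = ∑' i, ‖C (RealInterp.basis i)‖ₑ ^ 2 := by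
  rw [hilbertSchmidtNorm, ← ENNReal.rpow_natCast, ← ENNReal.rpow_mul]
  norm_num

theorem enorm_sq_eq_ofReal {V : Type*} [NormedAddCommGroup V] (y : V) :
    ‖y‖ₑ ^ 2 = ENNReal.ofReal (‖y‖ ^ 2) := by
  rw [← ofReal_norm, ← ENNReal.ofReal_pow (norm_nonneg _)]

/-- The coefficients of `F` along `y ⊗ [e_i]` are controlled by the interpolation norm. -/
theorem sum_inner_sq_le_interpNorm_sq {μ : ℕ → ℝ} (hμ : ∀ i, 0 < μ i) {v : ℕ → Lp ℝ 2 π}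
    (hv : Orthonormal ℝ v) {y : Y} (hy : ‖y‖ = 1) (γ : ℝ) {F : E → Y} (hF : MemLp F 2 π)
    (S : Finset ℕ) :
    ENNReal.ofReal (∑ i ∈ S, μ i ^ (-γ) * inner ℝ (elemTensor y (v i)) (hF.toLp F) ^ 2) ≤
      interpNorm μ v γ F ^ 2 := by
  rw [interpNorm, dif_pos hF]
  split_ifs with hγ
  · subst hγ
    have h1 : eLpNorm F 2 π ^ 2 = ENNReal.ofReal (‖hF.toLp F‖ ^ 2) := by
      rw [Lp.norm_toLp, ENNReal.ofReal_pow ENNReal.toReal_nonneg,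
        ENNReal.ofReal_toReal hF.eLpNorm_ne_top]
    rw [h1]
    refine ENNReal.ofReal_le_ofReal ?_
    simpa using (orthonormal_elemTensor hv hy).sum_inner_products_le (hF.toLp F) (s := S)
  · set A := ∑ i ∈ S, μ i ^ (-γ) * inner ℝ (elemTensor y (v i)) (hF.toLp F) ^ 2 with hA
    have hA0 : 0 ≤ A := Finset.sum_nonneg fun i _ =>
      mul_nonneg (Real.rpow_nonneg (hμ i).le _) (sq_nonneg _)
    have hsq : ENNReal.ofReal A = ENNReal.ofReal (√A) ^ 2 := by
      rw [← ENNReal.ofReal_pow (Real.sqrt_nonneg _), Real.sq_sqrt hA0]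
    rw [hsq]
    -- The bound is proved for every admissible `C`, so uniqueness of `C` plays no role. Pairing the
    -- series for `F` with `elemTensor y (v i)` isolates the `i`-th term.
    refine pow_le_pow_left₀ zero_le (le_iInf₂ fun C hC => ?_) 2
    rw [← ENNReal.pow_le_pow_left_iff (two_ne_zero (α := ℕ)), ← hsq,
      hilbertSchmidtNorm_sq]
    have hcoef : ∀ i, inner ℝ (elemTensor y (v i)) (hF.toLp F) =
        μ i ^ (γ / 2) * inner ℝ y (C (RealInterp.basis i)) := by
      intro i
      have h1 := (innerSL ℝ (elemTensor y (v i))).hasSum hC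
      refine h1.unique ?_
      have h2 : ∀ j, innerSL ℝ (elemTensor y (v i))
          (elemTensor (C (RealInterp.basis j)) (μ j ^ (γ / 2) • v j)) =
          if j = i then μ i ^ (γ / 2) * inner ℝ y (C (RealInterp.basis i)) else 0 := by
        intro j
        rw [innerSL_apply_apply, inner_elemTensor, inner_smul_right,
          orthonormal_iff_ite.1 hv i j]
        by_cases h : j = i
        · subst h
          simp only [if_true]
          ring
        · simp [h, Ne.symm h]
      simp only [h2]
      exact hasSum_ite_eq i _
    calc ENNReal.ofReal A ≤ ENNReal.ofReal (∑ i ∈ S, ‖C (RealInterp.basis i)‖ ^ 2) := by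
          refine ENNReal.ofReal_le_ofReal (Finset.sum_le_sum fun i _ => ?_)
          rw [hcoef, mul_pow, ← Real.rpow_natCast (μ i ^ (γ / 2)) 2, ← Real.rpow_mul (hμ i).le,
            ← mul_assoc, ← Real.rpow_add (hμ i)]
          have h3 : |inner ℝ y (C (RealInterp.basis i))| ≤ ‖C (RealInterp.basis i)‖ := by
            simpa [hy] using abs_real_inner_le_norm y (C (RealInterp.basis i))
          have h4 := pow_le_pow_left₀ (abs_nonneg _) h3 2
          rw [sq_abs] at h4
          simpa using h4
      _ = ∑ i ∈ S, ‖C (RealInterp.basis i)‖ₑ ^ 2 := by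
          rw [ENNReal.ofReal_sum_of_nonneg fun i _ => sq_nonneg _]
          exact Finset.sum_congr rfl fun i _ => (enorm_sq_eq_ofReal _).symm
      _ ≤ _ := ENNReal.sum_le_tsum S

theorem memLp_coe_smul (φ : Lp ℝ 2 π) (y : Y) : MemLp (fun x => φ x • y) 2 π :=
  (memLp_congr_ae (coeFn_elemTensor y φ)).1 (Lp.memLp _)

theorem toLp_coe_smul (φ : Lp ℝ 2 π) (y : Y) :
    (memLp_coe_smul φ y).toLp (fun x => φ x • y) = elemTensor y φ := by
  refine Lp.ext ?_
  filter_upwards [(memLp_coe_smul φ y).coeFn_toLp, coeFn_elemTensor y φ] with x h1 h2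
  rw [h1, h2]

/-- A finite combination of the `μ_i^{α/2} [e_i]`, times a unit vector, belongs to `[G]^α`, and its
norm is at most the `ℓ²`-norm of the coefficients. -/
theorem interpNorm_sum_smul_le {μ : ℕ → ℝ} {v : ℕ → Lp ℝ 2 π} {y : Y}
    (hy : ‖y‖ = 1) {α : ℝ} (hα : α ≠ 0) (S : Finset ℕ) (a : ℕ → ℝ) {B : ℝ} (hB : 0 ≤ B)
    (ha : ∑ i ∈ S, a i ^ 2 ≤ B ^ 2) {φ : Lp ℝ 2 π}
    (hφ : φ = ∑ i ∈ S, a i • μ i ^ (α / 2) • v i) :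
    interpNorm μ v α (fun x => φ x • y) ≤ ENNReal.ofReal B := by
  classical
  rw [interpNorm, dif_pos (memLp_coe_smul φ y), if_neg hα, toLp_coe_smul]
  set C : RealInterp →L[ℝ] Y :=
    ∑ i ∈ S, a i • (innerSL ℝ (RealInterp.basis i)).smulRight y with hC
  have hCb : ∀ j, C (RealInterp.basis j) = if j ∈ S then a j • y else 0 := by
    intro j
    have h1 : ∀ i, inner ℝ (RealInterp.basis i) (RealInterp.basis j) =
        if i = j then (1 : ℝ) else 0 := by
      intro i
      rw [RealInterp.basis, lp.inner_single_left, RealInterp.basis, lp.single_apply]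
      by_cases h : i = j
      · subst h; simp
      · simp [h]
    simp [hC, h1]
  refine iInf₂_le_of_le C ?_ ?_
  · have h2 : elemTensor y φ =
        ∑ i ∈ S, elemTensor (C (RealInterp.basis i)) (μ i ^ (α / 2) • v i) := by
      rw [hφ, elemTensor_eq_compLpL, map_sum]
      refine Finset.sum_congr rfl fun i hi => ?_
      rw [hCb, if_pos hi, elemTensor_smul_left, map_smul, elemTensor_eq_compLpL]
    rw [IsPsi, h2]
    refine hasSum_sum_of_ne_finset_zero fun i hi => ?_
    rw [hCb, if_neg hi, ← zero_smul ℝ (0 : Y), elemTensor_smul_left, zero_smul]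
  · rw [← ENNReal.pow_le_pow_left_iff (two_ne_zero (α := ℕ)),
      hilbertSchmidtNorm_sq, tsum_eq_sum (s := S) fun i hi => by simp [hCb, hi],
      ← ENNReal.ofReal_pow hB]
    refine le_trans (le_of_eq ?_) (ENNReal.ofReal_le_ofReal ha)
    rw [ENNReal.ofReal_sum_of_nonneg fun i _ => sq_nonneg _]
    refine Finset.sum_congr rfl fun i hi => ?_
    rw [hCb, if_pos hi, enorm_sq_eq_ofReal, norm_smul, hy, mul_one, Real.norm_eq_abs, sq_abs]

end InterpolationBounds

/-! ### Testing on the hypercube -/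

section Hypercube

/-- A set of vertices of the hypercube with diameter at most `m / 4` is exponentially small. -/
theorem card_le_of_hammingDist_le {m : ℕ} (s : Finset (Fin m → Bool))
    (hs : ∀ w ∈ s, ∀ w' ∈ s, 4 * hammingDist w w' ≤ m) :
    (s.card : ℝ) ≤ (3 / 2) ^ m * 2 ^ ((m : ℝ) / 4) := by
  rcases s.eq_empty_or_nonempty with rfl | ⟨w₀, hw₀⟩
  · simp only [Finset.card_empty, Nat.cast_zero]
    positivity
  -- A Chernoff-type count: give `w` the weight `2^{-hammingDist w w₀}`. The total weight factorises
  -- over coordinates, and each element of `s` has weight at least `2^{-m/4}`.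
  have hsum : ∑ w : Fin m → Bool, ∏ i, (if w i = w₀ i then (1 : ℝ) else 1 / 2) =
      (3 / 2) ^ m := by
    have h1 := Finset.prod_univ_sum (fun _ : Fin m => (Finset.univ : Finset Bool))
      fun i b => if b = w₀ i then (1 : ℝ) else 1 / 2
    rw [Fintype.piFinset_univ] at h1
    rw [← h1]
    have h2 : ∀ i, ∑ b : Bool, (if b = w₀ i then (1 : ℝ) else 1 / 2) = 3 / 2 := by
      intro i
      cases w₀ i <;> norm_num
    rw [Finset.prod_congr rfl fun i _ => h2 i]
    simp [div_pow]
  have hle : ∀ w ∈ s, (2 : ℝ) ^ (-((m : ℝ) / 4)) ≤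
      ∏ i, (if w i = w₀ i then (1 : ℝ) else 1 / 2) := by
    intro w hw
    have h1 : ∏ i, (if w i = w₀ i then (1 : ℝ) else 1 / 2) = (1 / 2) ^ hammingDist w w₀ := by
      rw [Finset.prod_ite]
      simp [hammingDist]
    have h2 : ((4 * hammingDist w w₀ : ℕ) : ℝ) ≤ m := by exact_mod_cast hs w hw w₀ hw₀
    push_cast at h2
    rw [h1, one_div, inv_pow, ← Real.rpow_natCast, ← Real.rpow_neg two_pos.le]
    exact Real.rpow_le_rpow_of_exponent_le one_le_two (by linarith)
  have h3 : (s.card : ℝ) * 2 ^ (-((m : ℝ) / 4)) ≤ (3 / 2) ^ m := by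
    rw [← hsum, ← nsmul_eq_mul]
    refine (Finset.card_nsmul_le_sum s _ _ hle).trans ?_
    exact Finset.sum_le_univ_sum_of_nonneg fun w =>
      Finset.prod_nonneg fun i _ => by split_ifs <;> norm_num
  rwa [Real.rpow_neg two_pos.le, ← div_eq_mul_inv, div_le_iff₀ (by positivity)] at h3

/-- The exponential rate in the testing bound `le_of_le_pi_real`. -/
noncomputable def hypercubeRate : ℝ := 3 / 4 * 2 ^ (1 / 4 : ℝ) * Real.exp (1 / 20)

theorem hypercubeRate_pos : 0 < hypercubeRate := by
  unfold hypercubeRate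
  positivity

theorem hypercubeRate_lt_one : hypercubeRate < 1 := by
  -- The fourth power removes the root of `2`; with `exp (1/5) ≤ 5/4` it is at most `405/512`.
  have h1 : hypercubeRate ^ 4 = 81 / 128 * Real.exp (1 / 5) := by
    rw [hypercubeRate, mul_pow, mul_pow, ← Real.rpow_natCast (2 ^ (1 / 4 : ℝ)),
      ← Real.rpow_mul two_pos.le, ← Real.exp_nat_mul]
    norm_num
  have h2 : Real.exp (1 / 5) ≤ 5 / 4 := by
    have h := Real.exp_bound_div_one_sub_of_interval (x := 1 / 5) (by norm_num) (by norm_num)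
    norm_num at h ⊢
    exact h
  by_contra! h
  have := one_le_pow₀ h (n := 4)
  linarith

theorem hypercubeRate_pow (m : ℕ) :
    Real.exp (m / 20) * ((3 / 2) ^ m * 2 ^ ((m : ℝ) / 4)) = 2 ^ m * hypercubeRate ^ m := by
  have h1 : (2 : ℝ) ^ ((m : ℝ) / 4) = (2 ^ (1 / 4 : ℝ)) ^ m := by
    rw [← Real.rpow_natCast (2 ^ (1 / 4 : ℝ)), ← Real.rpow_mul two_pos.le]
    congr 1
    ring
  have h2 : Real.exp (m / 20) = Real.exp (1 / 20) ^ m := by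
    rw [← Real.exp_nat_mul]
    congr 1
    ring
  rw [h1, h2, ← mul_pow, ← mul_pow, ← mul_pow, hypercubeRate]
  congr 1
  ring

/-- If data from hypotheses indexed by the hypercube, with relative entropies at most `m K`, can be
classified up to Hamming distance `m / 4`, then the success probability is small. -/
theorem le_of_le_pi_real {Z : Type*} [MeasurableSpace Z] {n m : ℕ} (hm : 0 < m)
    (Q : Measure Z) [IsProbabilityMeasure Q]
    (P : (Fin m → Bool) → Measure Z) [∀ w, IsProbabilityMeasure (P w)]
    (l : (Fin m → Bool) → Z → ℝ) (hl : ∀ w, Measurable (l w))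
    (hP : ∀ w, P w = Q.withDensity fun z => ENNReal.ofReal (Real.exp (l w z)))
    (hint : ∀ w, Integrable (l w) (P w)) {K : ℝ} (hK : ∀ w, n * ∫ z, l w z ∂(P w) ≤ m * K)
    (B : (Fin m → Bool) → Set (Fin n → Z)) (hB : ∀ w, MeasurableSet (B w))
    (hdist : ∀ w w' z, z ∈ B w → z ∈ B w' → 4 * hammingDist w w' ≤ m)
    {η : ℝ} (hη : ∀ w, η ≤ (Measure.pi fun _ : Fin n => P w).real (B w)) :
    η ≤ hypercubeRate ^ m + 20 * K + 20 / m := by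
  have hm' : (0 : ℝ) < m := by exact_mod_cast hm
  -- The threshold `t = m / 20` grows with `m`, so the entropy term stays of order `K`, yet `exp t`
  -- is small enough to keep `hypercubeRate` below `1`.
  have h1 : ∀ w, η ≤ Real.exp (m / 20) * (Measure.pi fun _ : Fin n => Q).real (B w) +
      (20 * K + 20 / m) := by
    intro w
    have h := pi_real_le_exp_mul_add (n := n) Q (P w) (l w) (hl w) (hP w) (hint w)
      (t := m / 20) (by positivity) (hB w)
    have h2 : (n * ∫ z, l w z ∂(P w) + 1) / (m / 20) ≤ 20 * K + 20 / m := by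
      rw [div_le_iff₀ (by positivity)]
      have h3 : (20 * K + 20 / m) * (m / 20) = m * K + 1 := by field_simp
      rw [h3]
      linarith [hK w]
    linarith [hη w]
  have h2 := Finset.sum_le_sum fun w (_ : w ∈ Finset.univ) => h1 w
  rw [Finset.sum_add_distrib, ← Finset.mul_sum] at h2
  simp only [Finset.sum_const, Finset.card_univ, Fintype.card_fun, Fintype.card_bool,
    Fintype.card_fin, nsmul_eq_mul] at h2
  push_cast at h2
  have h3 := sum_real_le_of_card_le (Measure.pi fun _ : Fin n => Q) B hB _ fun z s hs =>
    card_le_of_hammingDist_le s fun w hw w' hw' => hdist w w' z (hs w hw) (hs w' hw')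
  have h4 := mul_le_mul_of_nonneg_left h3 (Real.exp_pos (m / 20)).le
  rw [hypercubeRate_pow] at h4
  have h5 : (2 : ℝ) ^ m * η ≤ 2 ^ m * (hypercubeRate ^ m + 20 * K + 20 / m) := by linarith
  exact le_of_mul_le_mul_left h5 (by positivity)

end Hypercube

/-! ### The hypotheses -/

section Hypotheses

variable {E : Type*} [MeasurableSpace E] {π : Measure E}
  {Y : Type*} [NormedAddCommGroup Y] [InnerProductSpace ℝ Y]

/-- The element `d ∑_j w_j [e_{m+j}]`, for a vertex `w` of the hypercube. -/
noncomputable def vertexFun (v : ℕ → Lp ℝ 2 π) {m : ℕ} (d : ℝ) (w : Fin m → Bool) : Lp ℝ 2 π :=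
  ∑ j : Fin m, (if w j then d else 0) • v (m + j)

theorem orthonormal_shift {v : ℕ → Lp ℝ 2 π} (hv : Orthonormal ℝ v) (m : ℕ) :
    Orthonormal ℝ fun j : Fin m => v (m + j) :=
  hv.comp (fun j : Fin m => m + (j : ℕ)) fun i j h => Fin.ext (by simpa using h)

theorem inner_vertexFun {v : ℕ → Lp ℝ 2 π} (hv : Orthonormal ℝ v) {m : ℕ} (d : ℝ)
    (w : Fin m → Bool) (j : Fin m) :
    inner ℝ (v (m + j)) (vertexFun v d w) = if w j then d else 0 :=
  (orthonormal_shift hv m).inner_right_fintype _ j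

theorem integral_vertexFun_sq_le {v : ℕ → Lp ℝ 2 π} (hv : Orthonormal ℝ v) {m : ℕ} (d : ℝ)
    (w : Fin m → Bool) : ∫ x, vertexFun v d w x ^ 2 ∂π ≤ m * d ^ 2 := by
  have h1 : ∫ x, vertexFun v d w x ^ 2 ∂π =
      inner ℝ (vertexFun v d w) (vertexFun v d w) := by
    rw [L2.inner_def]
    refine integral_congr_ae (.of_forall fun x => ?_)
    simp [sq]
  rw [h1]
  nth_rw 1 [vertexFun]
  rw [sum_inner]
  calc ∑ j : Fin m, inner ℝ ((if w j then d else 0) • v (m + j)) (vertexFun v d w)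
      ≤ ∑ _j : Fin m, d ^ 2 := by
        refine Finset.sum_le_sum fun j _ => ?_
        rw [real_inner_smul_left, inner_vertexFun hv]
        split_ifs
        · exact (sq d).ge
        · simpa using sq_nonneg d
    _ = m * d ^ 2 := by simp

theorem interpNorm_vertexFun_le {μ : ℕ → ℝ} (hμ : ∀ i, 0 < μ i) {v : ℕ → Lp ℝ 2 π} {y : Y}
    (hy : ‖y‖ = 1) {α : ℝ} (hα : α ≠ 0) {m : ℕ} {d B W : ℝ} (hB : 0 ≤ B)
    (hW : ∀ j : Fin m, μ (m + j) ^ (-α) ≤ W) (hmd : m * (d ^ 2 * W) ≤ B ^ 2)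
    (w : Fin m → Bool) :
    interpNorm μ v α (fun x => vertexFun v d w x • y) ≤ ENNReal.ofReal B := by
  set sh : Fin m ↪ ℕ := ⟨fun j => m + j, fun i j h => Fin.ext (by simpa using h)⟩
  have hshj : ∀ j : Fin m, sh j = m + j := fun _ => rfl
  set b : ℕ → ℝ := Function.extend sh (fun j => if w j then d else 0) 0
  have hbj : ∀ j : Fin m, b (sh j) = if w j then d else 0 := fun j =>
    sh.injective.extend_apply _ _ j
  -- Relative to the basis `μ_i^{α/2} [e_i]` of `[H]^α`, the coefficients `b i` are divided by
  -- `μ_i^{α/2}`.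
  refine interpNorm_sum_smul_le hy hα (Finset.univ.map sh) (fun i => b i * μ i ^ (-(α / 2))) hB
    ?_ ?_
  · rw [Finset.sum_map]
    refine le_trans (Finset.sum_le_sum (g := fun _ => d ^ 2 * W) fun j _ => ?_) (by simpa using hmd)
    rw [hbj, mul_pow, ← Real.rpow_natCast (μ _ ^ _) 2, ← Real.rpow_mul (hμ _).le,
      show -(α / 2) * ((2 : ℕ) : ℝ) = -α by push_cast; ring]
    have h0 : 0 ≤ μ (sh j) ^ (-α) := Real.rpow_nonneg (hμ _).le _
    refine mul_le_mul ?_ (hW j) h0 (sq_nonneg d)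
    split_ifs
    · exact le_rfl
    · simpa using sq_nonneg d
  · rw [Finset.sum_map, vertexFun]
    refine Finset.sum_congr rfl fun j _ => ?_
    rw [hbj, smul_smul, mul_assoc, ← Real.rpow_add (hμ _)]
    simp [hshj]

/-- Two vertices whose functions are both close to a given function are close to each other. -/
theorem hammingDist_le_of_interpNorm_lt {μ : ℕ → ℝ} (hμ : ∀ i, 0 < μ i) {v : ℕ → Lp ℝ 2 π}
    (hv : Orthonormal ℝ v) {y : Y} (hy : ‖y‖ = 1) {γ : ℝ} {m : ℕ} {d W δ : ℝ} (hd : d ≠ 0)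
    (hW0 : 0 < W) (hW : ∀ j : Fin m, W ≤ μ (m + j) ^ (-γ)) (hδ : 16 * δ ≤ W * d ^ 2 * m)
    (F : E → Y) (w w' : Fin m → Bool)
    (h : interpNorm μ v γ (fun x => F x - vertexFun v d w x • y) ^ 2 < ENNReal.ofReal δ)
    (h' : interpNorm μ v γ (fun x => F x - vertexFun v d w' x • y) ^ 2 < ENNReal.ofReal δ) :
    4 * hammingDist w w' ≤ m := by
  set sh : Fin m ↪ ℕ := ⟨fun j => m + j, fun i j h => Fin.ext (by simpa using h)⟩
  have hmem : ∀ w : Fin m → Bool,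
      interpNorm μ v γ (fun x => F x - vertexFun v d w x • y) ^ 2 < ENNReal.ofReal δ →
      MemLp (fun x => F x - vertexFun v d w x • y) 2 π := by
    intro w h
    by_contra hn
    rw [interpNorm, dif_neg hn] at h
    simp at h
  have hsum : ∀ (w : Fin m → Bool)
      (hm : MemLp (fun x => F x - vertexFun v d w x • y) 2 π),
      interpNorm μ v γ (fun x => F x - vertexFun v d w x • y) ^ 2 < ENNReal.ofReal δ →
      ∑ j : Fin m, μ (m + j) ^ (-γ) * inner ℝ (elemTensor y (v (m + j))) (hm.toLp _) ^ 2 < δ := by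
    intro w hm h
    have h1 := (sum_inner_sq_le_interpNorm_sq hμ hv hy γ hm (Finset.univ.map sh)).trans_lt h
    rw [Finset.sum_map] at h1
    exact (ENNReal.ofReal_lt_ofReal_iff_of_nonneg (Finset.sum_nonneg fun j _ =>
      mul_nonneg (Real.rpow_nonneg (hμ _).le _) (sq_nonneg _))).1 h1
  have hm := hmem w h
  have hm' := hmem w' h'
  have hs := hsum w hm h
  have hs' := hsum w' hm' h'
  -- `F` cancels in the difference of the two residuals; only the residuals need be square
  -- integrable, which the value `∞` elsewhere ensures.
  have hdiff : ∀ j : Fin m, inner ℝ (elemTensor y (v (m + j))) (hm.toLp _) -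
      inner ℝ (elemTensor y (v (m + j))) (hm'.toLp _) =
      (if w' j then d else 0) - (if w j then d else 0) := by
    intro j
    have h1 : hm.toLp _ - hm'.toLp _ =
        elemTensor y (vertexFun v d w') - elemTensor y (vertexFun v d w) := by
      rw [← toLp_coe_smul, ← toLp_coe_smul, ← MemLp.toLp_sub, ← MemLp.toLp_sub]
      refine MemLp.toLp_congr _ _ (.of_forall fun x => ?_)
      simp
    rw [← inner_sub_right, h1, inner_sub_right, inner_elemTensor, inner_elemTensor,
      inner_vertexFun hv, inner_vertexFun hv, real_inner_self_eq_norm_sq, hy]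
    ring
  have hterm : ∀ j : Fin m, W * d ^ 2 * (if w j ≠ w' j then 1 else 0) ≤
      2 * (μ (m + j) ^ (-γ) * inner ℝ (elemTensor y (v (m + j))) (hm.toLp _) ^ 2) +
      2 * (μ (m + j) ^ (-γ) * inner ℝ (elemTensor y (v (m + j))) (hm'.toLp _) ^ 2) := by
    intro j
    have h2 := hdiff j
    set c := inner ℝ (elemTensor y (v (m + j))) (hm.toLp _)
    set c' := inner ℝ (elemTensor y (v (m + j))) (hm'.toLp _)
    have h3 : d ^ 2 * (if w j ≠ w' j then 1 else 0) = (c - c') ^ 2 := by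
      rw [h2]
      cases w j <;> cases w' j <;> simp
    calc W * d ^ 2 * (if w j ≠ w' j then 1 else 0) = W * (c - c') ^ 2 := by rw [← h3]; ring
      _ ≤ μ (m + j) ^ (-γ) * (c - c') ^ 2 := mul_le_mul_of_nonneg_right (hW j) (sq_nonneg _)
      _ ≤ μ (m + j) ^ (-γ) * (2 * c ^ 2 + 2 * c' ^ 2) :=
          mul_le_mul_of_nonneg_left (by nlinarith [sq_nonneg (c + c')])
            (Real.rpow_nonneg (hμ _).le _)
      _ = _ := by ring
  have h4 := Finset.sum_le_sum fun j (_ : j ∈ Finset.univ) => hterm j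
  rw [← Finset.mul_sum, Finset.sum_add_distrib, ← Finset.mul_sum, ← Finset.mul_sum,
    Finset.sum_boole] at h4
  -- Both residual sums are below `δ`, so `W d²` times the Hamming distance is at most `4 δ`; hence
  -- the `16` in `hδ`.
  have h5 : W * d ^ 2 * (4 * hammingDist w w' : ℝ) ≤ W * d ^ 2 * m := by
    rw [hammingDist]
    linarith
  have h6 := le_of_mul_le_mul_left h5 (by positivity)
  exact_mod_cast h6

end Hypotheses

/-! ### The choice of the parameters -/

section Rates

theorem EigenvalueDecay.rpow_neg_le {μ : ℕ → ℝ} {p c₁ c₂ : ℝ} (h : EigenvalueDecay μ p c₁ c₂)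
    (hp : 0 < p) (hc₂ : 0 < c₂) {β : ℝ} (hβ : 0 ≤ β) {m : ℕ} (hm : 0 < m) (j : Fin m) :
    μ (m + j) ^ (-β) ≤ c₂ ^ (-β) * 2 ^ (β / p) * (m : ℝ) ^ (β / p) := by
  have hm' : (0 : ℝ) < m := by exact_mod_cast hm
  have h1 : c₂ * (2 * m : ℝ) ^ (-(1 / p)) ≤ μ (m + j) := by
    refine le_trans (mul_le_mul_of_nonneg_left ?_ hc₂.le) (h (m + j)).1
    refine Real.rpow_le_rpow_of_nonpos (by positivity) ?_ (by simp [hp.le])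
    -- With indices from zero, the block has ranks `m + 1` to `2 m`, which gives the factor `2 ^ (β
    -- / p)`.
    have : ((m + j + 1 : ℕ) : ℝ) ≤ ((2 * m : ℕ) : ℝ) := Nat.cast_le.2 (by omega)
    push_cast at this ⊢
    exact this
  refine (Real.rpow_le_rpow_of_nonpos (by positivity) h1 (by simpa using hβ)).trans (le_of_eq ?_)
  rw [Real.mul_rpow hc₂.le (by positivity), ← Real.rpow_mul (by positivity), mul_assoc,
    ← Real.mul_rpow two_pos.le hm'.le]
  congr 2
  ring

theorem EigenvalueDecay.le_rpow_neg {μ : ℕ → ℝ} {p c₁ c₂ : ℝ} (h : EigenvalueDecay μ p c₁ c₂)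
    (hμ : ∀ i, 0 < μ i) (hp : 0 < p) (hc₁ : 0 < c₁) {γ : ℝ} (hγ : 0 ≤ γ) {m : ℕ} (hm : 0 < m)
    (j : Fin m) : c₁ ^ (-γ) * (m : ℝ) ^ (γ / p) ≤ μ (m + j) ^ (-γ) := by
  have hm' : (0 : ℝ) < m := by exact_mod_cast hm
  have h1 : μ (m + j) ≤ c₁ * (m : ℝ) ^ (-(1 / p)) := by
    refine (h (m + j)).2.trans (mul_le_mul_of_nonneg_left ?_ hc₁.le)
    refine Real.rpow_le_rpow_of_nonpos hm' ?_ (by simp [hp.le])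
    push_cast
    have : (0 : ℝ) ≤ (j : ℕ) := Nat.cast_nonneg _
    linarith
  refine le_trans (le_of_eq ?_) (Real.rpow_le_rpow_of_nonpos (hμ _) h1 (by simpa using hγ))
  rw [Real.mul_rpow hc₁.le (by positivity), ← Real.rpow_mul hm'.le]
  congr 2
  ring

/-- For every sample size `n` large enough there is a dimension `m` of the hypercube which balances
the source condition, the separation of the hypotheses and the testing error. -/
theorem eventually_exists_dimension {p β γ A ρ q : ℝ} (hp : 0 < p) (hβ : 0 < β) (hγ : 0 ≤ γ)
    (hA : 0 < A) (hρ : 0 < ρ) (hq0 : 0 < q) (hq1 : q < 1) :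
    ∀ᶠ n : ℕ in atTop, ∃ m : ℕ, 0 < n ∧ 0 < m ∧
      m * (ρ / n * (m : ℝ) ^ (β / p)) ≤ A ∧
      (2 ^ (γ / p + 1))⁻¹ * A ^ ((γ + p) / (β + p)) * (ρ / n) ^ ((β - γ) / (β + p)) ≤
        (m : ℝ) ^ (γ / p) * (ρ / n) * m ∧
      q ^ m + 20 / m < ρ := by
  -- The real solution of `x^{1+β/p} ρ / n = A`, i.e. equality in the source constraint. Rounding
  -- down preserves the constraint and loses at most a factor `2` once `x n ≥ 2`, which explains `2
  -- ^ (γ / p + 1)`.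
  set x : ℕ → ℝ := fun n => (A / ρ * n) ^ (p / (β + p)) with hx
  have hxlim : Tendsto x atTop atTop :=
    (tendsto_rpow_atTop (by positivity)).comp
      (tendsto_natCast_atTop_atTop.const_mul_atTop (by positivity))
  have hmlim : Tendsto (fun n => ⌊x n⌋₊) atTop atTop := tendsto_nat_floor_atTop.comp hxlim
  have hsmall : Tendsto (fun m : ℕ => q ^ m + 20 / (m : ℝ)) atTop (𝓝 (0 + 0)) :=
    (tendsto_pow_atTop_nhds_zero_of_lt_one hq0.le hq1).add
      (tendsto_const_div_atTop_nhds_zero_nat 20)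
  rw [add_zero] at hsmall
  filter_upwards [hmlim.eventually (hsmall.eventually (gt_mem_nhds hρ)),
    hxlim.eventually_ge_atTop 2, eventually_gt_atTop 0] with n hn1 hn2 hn3
  have hn : (0 : ℝ) < n := by exact_mod_cast hn3
  have hx0 : 0 < x n := by linarith
  have hfl : (⌊x n⌋₊ : ℝ) ≤ x n := Nat.floor_le hx0.le
  have hfl2 : x n / 2 ≤ ⌊x n⌋₊ := by
    have := Nat.lt_floor_add_one (x n)
    linarith
  set m := ⌊x n⌋₊
  have hm : (0 : ℝ) < m := by linarith
  refine ⟨m, hn3, by exact_mod_cast hm, ?_, ?_, hn1⟩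
  · have h1 : (m : ℝ) * (m : ℝ) ^ (β / p) ≤ A / ρ * n := by
      calc (m : ℝ) * (m : ℝ) ^ (β / p) = (m : ℝ) ^ ((β + p) / p) := by
            rw [← Real.rpow_one_add' hm.le (by positivity)]
            congr 1
            field_simp
            ring
        _ ≤ x n ^ ((β + p) / p) := Real.rpow_le_rpow hm.le hfl (by positivity)
        _ = A / ρ * n := by
            rw [hx, ← Real.rpow_mul (by positivity),
              show p / (β + p) * ((β + p) / p) = 1 by field_simp, Real.rpow_one]
    calc m * (ρ / n * (m : ℝ) ^ (β / p)) = ρ / n * (m * (m : ℝ) ^ (β / p)) := by ring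
      _ ≤ ρ / n * (A / ρ * n) := by gcongr
      _ = A := by rw [div_mul_comm, mul_div_cancel_right₀ _ hn.ne', div_mul_cancel₀ _ hρ.ne']
  · have h1 : (2 ^ (γ / p + 1))⁻¹ * (A ^ ((γ + p) / (β + p)) * (n / ρ) ^ ((γ + p) / (β + p))) ≤
        (m : ℝ) ^ (γ / p + 1) := by
      calc (2 ^ (γ / p + 1))⁻¹ * (A ^ ((γ + p) / (β + p)) * (n / ρ) ^ ((γ + p) / (β + p)))
          = (2 ^ (γ / p + 1))⁻¹ * x n ^ (γ / p + 1) := by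
            rw [hx, ← Real.rpow_mul (by positivity), ← Real.mul_rpow hA.le (by positivity)]
            congr 2
            · ring
            · field_simp
        _ = (x n / 2) ^ (γ / p + 1) := by
            rw [Real.div_rpow hx0.le two_pos.le]
            ring
        _ ≤ _ := Real.rpow_le_rpow (by positivity) hfl2 (by positivity)
    have h2 : (ρ / n) ^ ((β - γ) / (β + p)) = ρ / n * (n / ρ) ^ ((γ + p) / (β + p)) := by
      rw [← inv_div ρ (n : ℝ), Real.inv_rpow (by positivity), ← Real.rpow_neg (by positivity),
        show (β - γ) / (β + p) = 1 + -((γ + p) / (β + p)) by field_simp; ring,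
        Real.rpow_add (by positivity), Real.rpow_one]
    calc (2 ^ (γ / p + 1))⁻¹ * A ^ ((γ + p) / (β + p)) * (ρ / n) ^ ((β - γ) / (β + p))
        = ρ / n * ((2 ^ (γ / p + 1))⁻¹ *
          (A ^ ((γ + p) / (β + p)) * (n / ρ) ^ ((γ + p) / (β + p)))) := by rw [h2]; ring
      _ ≤ ρ / n * (m : ℝ) ^ (γ / p + 1) := by gcongr
      _ = _ := by
          rw [Real.rpow_add_one hm.ne']
          ring

end Rates

end VectorRegression

/-! ### The lower bound -/

open VectorRegression in
theorem theorem5p1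
    {E : Type*} [TopologicalSpace E] [SecondCountableTopology E] [LocallyCompactSpace E] [T2Space E]
    [MeasurableSpace E] [BorelSpace E]
    {Y : Type*} [NormedAddCommGroup Y] [InnerProductSpace ℝ Y] [CompleteSpace Y]
    [TopologicalSpace.SeparableSpace Y] [MeasurableSpace Y] [BorelSpace Y] [Nontrivial Y]
    {H : Type*} [NormedAddCommGroup H] [InnerProductSpace ℝ H] [CompleteSpace H]
    [TopologicalSpace.SeparableSpace H] [RKHS ℝ H E ℝ]
    (π : Measure E) [IsProbabilityMeasure π]
    (κ : ℝ) (hk : KernelAssumptions H π κ)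
    (μ : ℕ → ℝ) (e : ℕ → H) (he : IsEigensystem hk μ e)
    (p c₁ c₂ : ℝ) (hp : 0 < p) (hp1 : p ≤ 1) (hc₁ : 0 < c₁) (hc₂ : 0 < c₂)
    (hdecay : EigenvalueDecay μ p c₁ c₂)
    (β γ : ℝ) (hβ : 0 < β) (hβ2 : β ≤ 2) (hγ : 0 ≤ γ) (hγ1 : γ ≤ 1) (hγβ : γ < β)
    (σ R B : ℝ) (hσ : 0 < σ) (hR : 0 < R) (hB : 0 < B) :
    ∃ J₀ J θ : ℝ, 0 < J₀ ∧ 0 < J ∧ 0 < θ ∧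
      ∀ (Fhat : LearningMethod E Y) (τ : ℝ), 0 < τ → ∀ᶠ n : ℕ in atTop,
        ∃ (P : Measure (E × Y)) (κY : Kernel E Y), IsMarkovKernel κY ∧ P = π ⊗ₘ κY ∧
          (∫⁻ z, ‖z.2‖ₑ ^ 2 ∂P < ∞) ∧
          interpNorm μ (fun i => embedding hk (e i)) β (regressionFun κY) ≤ ENNReal.ofReal B ∧
          MomentCondition π κY σ R ∧
          ENNReal.ofReal (1 - J₀ * τ ^ (1 / θ)) ≤
            (Measure.pi fun _ : Fin n => P)
              {D | ENNReal.ofReal (τ ^ 2 * J * (n : ℝ) ^ (-((β - γ) / (β + p)))) ≤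
                interpNorm μ (fun i => embedding hk (e i)) γ
                  (fun x => Fhat n D x - regressionFun κY x) ^ 2} := by
  set V : ℕ → Lp ℝ 2 π := fun i => embedding hk (e i)
  have hV : Orthonormal ℝ V := he.orthonormal
  have hμ := he.pos
  obtain ⟨y₀, hy⟩ : ∃ y : Y, ‖y‖ = 1 := exists_norm_eq Y zero_le_one
  obtain ⟨s, hs, hsR, hsσ⟩ : ∃ s : ℝ, 0 < s ∧ s ≤ R ∧ 8 * s ^ 2 ≤ σ ^ 2 := by
    refine ⟨min R (σ / 3), by positivity, min_le_left _ _, ?_⟩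
    have h := pow_le_pow_left₀ (by positivity) (min_le_right R (σ / 3)) 2
    nlinarith [sq_nonneg σ]
  set v : NNReal := (s ^ 2).toNNReal
  have hv : (v : ℝ) = s ^ 2 := Real.coe_toNNReal _ (sq_nonneg s)
  have hv0 : v ≠ 0 := by
    rw [← NNReal.coe_ne_zero, hv]
    positivity
  -- `B²` divided by the constant of `EigenvalueDecay.rpow_neg_le`: the budget for `d² m^{1+β/p}`.
  set A : ℝ := B ^ 2 * (c₂ ^ (-β) * 2 ^ (β / p))⁻¹ with hA
  have hA0 : 0 < A := by positivity
  set J : ℝ := c₁ ^ (-γ) * ((2 ^ (γ / p + 1))⁻¹ * A ^ ((γ + p) / (β + p))) / 16 with hJ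
  -- Chosen so that `ρ = τ^{1/θ}` satisfies `ρ^{(β-γ)/(β+p)} = τ²`.
  set θ : ℝ := (β - γ) / (2 * (β + p)) with hθ
  have hθ0 : 0 < θ := div_pos (by linarith) (by positivity)
  -- The testing bound has entropy term `20 K = 10 ρ / s²`; the extra `1` pays for the remainder,
  -- which is below `ρ` for large `n`.
  refine ⟨10 / s ^ 2 + 1, J, θ, by positivity, by positivity, hθ0, fun Fhat τ hτ => ?_⟩
  set ρ : ℝ := τ ^ (1 / θ) with hρ
  have hρ0 : 0 < ρ := by positivity
  have hτρ : τ ^ 2 = ρ ^ ((β - γ) / (β + p)) := by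
    rw [hρ, ← Real.rpow_mul hτ.le, ← Real.rpow_natCast]
    congr 1
    rw [show (β - γ) / (β + p) = 2 * θ by rw [hθ]; field_simp]
    field_simp
    norm_num
  filter_upwards [eventually_exists_dimension hp hβ hγ hA0 hρ0 hypercubeRate_pos
    hypercubeRate_lt_one] with n ⟨m, hn, hm, hsource, hsep, htest⟩
  have hn' : (0 : ℝ) < n := by exact_mod_cast hn
  have hm' : (0 : ℝ) < m := by exact_mod_cast hm
  set d : ℝ := √(ρ / n) with hd
  have hd2 : d ^ 2 = ρ / n := Real.sq_sqrt (by positivity)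
  have hd0 : d ≠ 0 := by positivity
  set δ : ℝ := τ ^ 2 * J * (n : ℝ) ^ (-((β - γ) / (β + p))) with hδ
  have hδle : 16 * δ ≤ c₁ ^ (-γ) * (m : ℝ) ^ (γ / p) * d ^ 2 * m := by
    have h1 : δ = J * (ρ / n) ^ ((β - γ) / (β + p)) := by
      rw [hδ, hτρ, Real.div_rpow hρ0.le hn'.le, Real.rpow_neg hn'.le]
      ring
    rw [h1, hd2, hJ]
    have h2 := mul_le_mul_of_nonneg_left hsep (Real.rpow_nonneg hc₁.le (-γ))
    linarith
  have hsrc : m * (d ^ 2 * (c₂ ^ (-β) * 2 ^ (β / p) * (m : ℝ) ^ (β / p))) ≤ B ^ 2 := by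
    have hc : 0 < c₂ ^ (-β) * 2 ^ (β / p) := by positivity
    have h1 := mul_le_mul_of_nonneg_left hsource hc.le
    rw [hA] at h1
    rw [hd2]
    calc _ = c₂ ^ (-β) * 2 ^ (β / p) * (m * (ρ / n * (m : ℝ) ^ (β / p))) := by ring
      _ ≤ _ := h1
      _ = B ^ 2 := by field_simp
  set φ : (Fin m → Bool) → Lp ℝ 2 π := vertexFun V d
  have hφm : ∀ w, Measurable (φ w) := fun w => (Lp.stronglyMeasurable (φ w)).measurable
  set κY : (Fin m → Bool) → Kernel E Y := fun w => noiseKernel (φ w) (hφm w) v y₀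
  have hreg : ∀ w, regressionFun (κY w) = fun x => φ w x • y₀ := fun w =>
    funext fun x => regressionFun_noiseKernel x
  set T : (Fin m → Bool) → Set (Fin n → E × Y) := fun w =>
    {D | ENNReal.ofReal δ ≤ interpNorm μ V γ (fun x => Fhat n D x - φ w x • y₀) ^ 2} with hT
  -- If no vertex served as `P`, the method would succeed at all vertices at once, each time with
  -- probability at least `(10 / s ^ 2 + 1) * ρ`.
  by_contra hcon
  have hlt : ∀ w, (Measure.pi fun _ : Fin n => π ⊗ₘ κY w) (T w) <
      ENNReal.ofReal (1 - (10 / s ^ 2 + 1) * ρ) := by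
    intro w
    by_contra! h
    refine hcon ⟨π ⊗ₘ κY w, κY w, inferInstance, rfl,
      lintegral_enorm_sq_noiseKernel_lt_top π (Lp.memLp (φ w)) hy, ?_,
      momentCondition_noiseKernel π hs hsR hsσ hy, ?_⟩
    · rw [hreg]
      exact interpNorm_vertexFun_le hμ hy hβ.ne' hB.le
        (fun j => hdecay.rpow_neg_le hp hc₂ hβ.le hm j) hsrc w
    · rw [hreg]
      exact h
  have hQ : IsProbabilityMeasure ((gaussianReal 0 v).map fun r => r • y₀) :=
    Measure.isProbabilityMeasure_map measurable_smul_const'.aemeasurable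
  have hll := fun w => integrable_integral_noiseLogLikelihood (hf := hφm w) π (Lp.memLp (φ w))
    hv0 hy
  have hη := le_of_le_pi_real (n := n) hm (π.prod ((gaussianReal 0 v).map fun r => r • y₀))
    (fun w => π ⊗ₘ κY w) (fun w => noiseLogLikelihood (φ w) v y₀)
    (fun w => measurable_noiseLogLikelihood (hφm w))
    (fun w => compProd_noiseKernel_eq_withDensity π hv0 hy)
    (fun w => (hll w).1) (K := ρ / (2 * s ^ 2)) (fun w => by
      rw [(hll w).2, hv]
      have h1 := integral_vertexFun_sq_le hV d w
      rw [hd2] at h1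
      calc n * ((∫ x, φ w x ^ 2 ∂π) / (2 * s ^ 2)) ≤ n * (m * (ρ / n) / (2 * s ^ 2)) := by gcongr
        _ = _ := by field_simp)
    -- `Fhat` is arbitrary, so `T w` may fail to be measurable. The complement of its measurable
    -- hull lies in the success event, and its probability is `1` minus the outer probability of `T
    -- w`.
    (fun w => (toMeasurable (Measure.pi fun _ : Fin n => π ⊗ₘ κY w) (T w))ᶜ)
    (fun w => (measurableSet_toMeasurable _ _).compl)
    (fun w w' D hD hD' => by
      have hw : ∀ w, D ∈ (toMeasurable (Measure.pi fun _ : Fin n => π ⊗ₘ κY w) (T w))ᶜ →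
          interpNorm μ V γ (fun x => Fhat n D x - φ w x • y₀) ^ 2 < ENNReal.ofReal δ :=
        fun w h => not_le.1 fun h' => h (subset_toMeasurable _ _ h')
      exact hammingDist_le_of_interpNorm_lt hμ hV hy hd0 (by positivity)
        (fun j => hdecay.le_rpow_neg hμ hp hc₁ hγ hm j) hδle (Fhat n D) w w' (hw w hD) (hw w' hD'))
    (η := (10 / s ^ 2 + 1) * ρ) (fun w => by
      rw [probReal_compl_eq_one_sub (measurableSet_toMeasurable _ _), measureReal_def,
        measure_toMeasurable]
      have h1 := (ENNReal.toReal_lt_of_lt_ofReal (hlt w)).le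
      linarith)
  have h20 : 20 * (ρ / (2 * s ^ 2)) = 10 / s ^ 2 * ρ := by
    field_simp
    ring
  rw [h20] at hη
  linarith
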